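/- Let $\kappa>0$, and let $\phi_{\boldsymbol\theta}(\alpha^2,\omega)\ge 0$ be a probability density on $(0,\infty)\times\mathbb R$ (with respect to $d\alpha^2\,d\omega$) that is even in the frequency, $\phi_{\boldsymbol\theta}(\alpha^2,-\omega)=\phi_{\boldsymbol\theta}(\alpha^2,\omega)$. Let the pairs $(\alpha_i^2,\omega_i)\sim\phi_{\boldsymbol\theta}$, $i\ge 1$, and the pairs $(s_{i1},s_{i2})$, $i\ge1$, be all mutually independent, where $(s_{i1},s_{i2})$ has the von Mises distribution on the unit circle with mean direction $\mathbf m=\mathbf 1_2/\sqrt2$ and concentration $\kappa$, i.e. density $\frac{1}{2\pi\mathcal I_0(\kappa)}e^{\kappa\,\mathbf m^\top\mathbf s}$ with respect to arc length; $\mathcal I_n$ is the modified Bessel function of the first kind of order $n$, and $r_1=\mathcal I_1(\kappa)/\mathcal I_0(\kappa)$. The impulse response of the concatenation of $n_c$ one-dimensional quantum harmonic oscillators with these parameters is $$\tilde h(t)=\tilde h_{n_c}(t)=\sum_{i=1}^{n_c}\Big(\alpha_i^2e^{-\frac{\alpha_i^2t}{2}}\big(-s_{i1}\cos(\omega_it)+s_{i2}\sin(\omega_it)\big)+s_{i1}\,\delta(t)\Big),$$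 where the Dirac term $\delta(t)$ contributes nothing for $t>0$; by its value at $t=0$ we mean that of the sum without the Dirac term. Put $$\mu_h(t)=-\frac{r_1}{\sqrt2}\int_{-\infty}^{\infty}\int_0^\infty \alpha^2e^{-\frac{\alpha^2t}{2}}\cos(\omega t)\,\phi_{\boldsymbol\theta}(\alpha^2,\omega)\,d\alpha^2\,d\omega,$$ $$K_{\boldsymbol\theta}(t,t')=\frac12\int_{-\infty}^{\infty}\int_0^\infty \alpha^4e^{-\frac{\alpha^2(t+t')}{2}}\cos(\omega(t-t'))\,\phi_{\boldsymbol\theta}(\alpha^2,\omega)\,d\alpha^2\,d\omega-\mu_h(t)\mu_h(t').$$ 1. As $n_c\to\infty$, $$\sqrt{n_c}\Big(\frac1{n_c}\tilde h_{n_c}(t)-\mu_h(t)\Big)\stackrel{d}{\longrightarrow}\mathcal{GP}\big(0,K_{\boldsymbol\theta}(t,t')\big)$$ as processes on the time set $t>0$: a centred Gaussian process with covariance function $K_{\boldsymbol\theta}$ exists, and the joint distribution at any finitely many times converges weakly to that of this process. If moreover $\int\!\!\int\alpha^4\phi_{\boldsymbol\theta}(\alpha^2,\omega)\,d\alpha^2\,d\omega<\infty$,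 the same holds on the time set $t\ge0$. 2. If $\phi_{\boldsymbol\theta}(\alpha^2,\omega)=\frac{\alpha^2/2}{\pi(\omega^2+\alpha^4/4)}\,\mathrm{Unif}(\alpha^2;a_m,a_M)$, where $0<a_m<a_M$ and $\mathrm{Unif}(\cdot\,;a_m,a_M)$ is the density of the uniform distribution on $[a_m,a_M]$, then for $t>0$ $$\mu_h(t)=-\frac{r_1}{\sqrt2}\,\frac{(1+a_mt)e^{-a_mt}-e^{-a_Mt}(1+a_Mt)}{t^2(a_M-a_m)},$$ and for $t,t'\ge0$ with $\tau=\max(t,t')>0$ $$K_{\boldsymbol\theta}(t,t')=\frac12\cdot\frac{2\big[(1+a_m\tau+\frac{a_m^2\tau^2}{2})e^{-a_m\tau}-e^{-a_M\tau}(1+a_M\tau+\frac{a_M^2\tau^2}{2})\big]}{\tau^3(a_M-a_m)}-\mu_h(t)\mu_h(t').$$ -/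

import Mathlib

open MeasureTheory ProbabilityTheory Filter Topology

noncomputable section

namespace QWiener

/-- The modified Bessel function of the first kind `I_n(x)` of integer order `n ≥ 0`. -/
def besselI (n : ℕ) (x : ℝ) : ℝ :=
  ∑' m : ℕ, (x / 2) ^ (2 * m + n) / ((m.factorial : ℝ) * ((m + n).factorial : ℝ))

/-- The ratio `r_1 = I_1(κ) / I_0(κ)`. -/
def r₁ (κ : ℝ) : ℝ := besselI 1 κ / besselI 0 κ

/-- The von Mises(-Fisher) distribution on the unit circle of `ℝ²` with mean direction `m` and
concentration `κ`: density `exp (κ m·s) / (2π I_0(κ))` with respect to arc length, which is the image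
of Lebesgue measure on `(-π, π]` under `θ ↦ (cos θ, sin θ)`. -/
def vonMises (m : ℝ × ℝ) (κ : ℝ) : Measure (ℝ × ℝ) :=
  ((volume.restrict (Set.Ioc (-Real.pi) Real.pi)).map
      (fun θ : ℝ => (Real.cos θ, Real.sin θ))).withDensity
    (fun s => ENNReal.ofReal
      (Real.exp (κ * (m.1 * s.1 + m.2 * s.2)) / (2 * Real.pi * besselI 0 κ)))

/-- The mean direction `(1, 1) / √2`. -/
def diagDir : ℝ × ℝ := (1 / √2, 1 / √2)

/-- The measure on the pairs `(α², ω) ∈ (0, ∞) × ℝ` with Lebesgue density `φ(α², ω)`. -/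
def paramLaw (φ : ℝ → ℝ → ℝ) : Measure (ℝ × ℝ) :=
  (volume.restrict (Set.Ioi (0 : ℝ) ×ˢ (Set.univ : Set ℝ))).withDensity
    (fun p => ENNReal.ofReal (φ p.1 p.2))

/-- The impulse response of the concatenation of `n` one-dimensional quantum harmonic oscillators
with parameters `α i`, `ω i`, `s i = (s_{i1}, s_{i2})`, without the feedthrough `(∑ i, s_{i1}) δ(t)`,
which is concentrated at `t = 0`: for `t > 0` this is the value `h̃(t)`. -/
def impulseResponse (n : ℕ) (α ω : ℕ → ℝ) (s : ℕ → ℝ × ℝ) (t : ℝ) : ℝ :=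
  ∑ i ∈ Finset.range n, (α i) ^ 2 * Real.exp (-((α i) ^ 2 * t / 2)) *
    (-(s i).1 * Real.cos (ω i * t) + (s i).2 * Real.sin (ω i * t))

/-- The mean function `μ_h`; the variable `x` stands for `α²`. -/
def muH (κ : ℝ) (φ : ℝ → ℝ → ℝ) (t : ℝ) : ℝ :=
  -(r₁ κ / √2) * ∫ ω : ℝ, ∫ x in Set.Ioi (0 : ℝ),
    x * Real.exp (-(x * t / 2)) * Real.cos (ω * t) * φ x ω

/-- The limit kernel `K_θ`; the variable `x` stands for `α²`. -/
def limitKernel (κ : ℝ) (φ : ℝ → ℝ → ℝ) (t t' : ℝ) : ℝ :=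
  1 / 2 * (∫ ω : ℝ, ∫ x in Set.Ioi (0 : ℝ),
    x ^ 2 * Real.exp (-(x * (t + t') / 2)) * Real.cos (ω * (t - t')) * φ x ω)
    - muH κ φ t * muH κ φ t'

/-- The Cauchy-times-uniform density: `α²` is uniform on `[a_m, a_M]` and, given `α²`, `ω` is
Cauchy with location `0` and scale `α² / 2`. -/
def cauchyUniform (a_m a_M : ℝ) (x ω : ℝ) : ℝ :=
  (x / 2) / (Real.pi * (ω ^ 2 + x ^ 2 / 4)) *
    (Set.Icc a_m a_M).indicator (fun _ => 1 / (a_M - a_m)) x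

/-- The real processes `X n`, on the probability space `(Ω, P)`, converge in distribution as
`n → ∞`, on the time set `T`, to the Gaussian process `GP(0, K)`: such a process `G` exists, and all
finite-dimensional distributions converge weakly to those of `G`. -/
def ConvergesToGP {Ω : Type*} [MeasurableSpace Ω] (P : Measure Ω) [IsProbabilityMeasure P]
    (T : Set ℝ) (X : ℕ → ℝ → Ω → ℝ) (K : ℝ → ℝ → ℝ) : Prop :=
  ∃ (Ω' : Type) (_ : MeasurableSpace Ω') (Q : Measure Ω') (_ : IsProbabilityMeasure Q)
    (G : T → Ω' → ℝ),
    IsGaussianProcess G Q ∧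
    (∀ t : T, ∫ ω', G t ω' ∂Q = 0) ∧
    (∀ t t' : T, covariance (G t) (G t') Q = K t t') ∧
    ∀ (k : ℕ) (t : Fin k → T),
      TendstoInDistribution (fun (n : ℕ) (ω : Ω) (j : Fin k) => X n (t j) ω) atTop
        (fun (ω' : Ω') (j : Fin k) => G (t j) ω') (fun _ => P) Q

end QWiener

end

/-!
The renormalized sum of i.i.d. one-oscillator responses converges in finite-dimensional
distributions by the central limit theorem and the Cramér–Wold device. The limiting Gaussian process
is the image of the centred one-oscillator responses under an isonormal process, that is, a linear
isometry of `L²` into a Gaussian space.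

In the mean and the covariance of one response, the terms odd in `ω` vanish because the law of
`(α², ω)` is invariant under `ω ↦ -ω`. The remaining terms need only `E s₁ = r₁ / √2` and
`E s₁² = E s₂² = 1 / 2`: the distribution of `s` is symmetric about the diagonal and `|s| = 1`.

For the Cauchy-times-uniform density, the characteristic function `exp (-γ |t|)` of the Cauchy
distribution evaluates the integral over `ω`. With `γ = α² / 2` the exponents then combine through
`(t + t' + |t - t'|) / 2 = max t t'`, leaving an elementary integral over `α²`.
-/

namespace QWiener

open scoped NNReal ENNReal FourierTransform

section Isonormal

universe u

variable {Ω : Type*} {mΩ : MeasurableSpace Ω} {Q : Measure Ω}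

lemma aemeasurable_coeFn_Lp (f : Lp ℝ 2 Q) : AEMeasurable f Q :=
  (Lp.aestronglyMeasurable f).aemeasurable

lemma ae_eq_coeFn_sum_smul {ι : Type*} (s : Finset ι) (c : ι → ℝ) (f : ι → Lp ℝ 2 Q) :
    (fun o => ∑ i ∈ s, c i * f i o) =ᵐ[Q] ⇑(∑ i ∈ s, c i • f i) := by
  have hsmul : ∀ᵐ o ∂Q, ∀ i ∈ s, (c i • f i) o = c i * f i o := by
    rw [Finset.eventually_all]
    exact fun i _ => Lp.coeFn_smul (c i) (f i)
  filter_upwards [hsmul, Lp.coeFn_finsetSum s (fun i => c i • f i)] with o hsmul_o hsum_o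
  rw [hsum_o, Finset.sum_apply]
  exact (Finset.sum_congr rfl hsmul_o).symm

lemma isGaussianProcess_of_iIndepFun {ι : Type*} {X : ι → Ω → ℝ}
    (hX : ∀ i, HasGaussianLaw (X i) Q) (hind : iIndepFun X Q) : IsGaussianProcess X Q where
  hasGaussianLaw I :=
    (hind.precomp (g := ((↑) : I → ι)) Subtype.val_injective).hasGaussianLaw fun i => hX i

variable {H : Type u} [NormedAddCommGroup H] [InnerProductSpace ℝ H]

/-- An isonormal Gaussian process over the Hilbert space `H`: a linear isometry `W` of `H` into
`L²(Q)` all of whose values are centred Gaussian; the variance of `W h` is then `‖h‖²`. -/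
def IsIsonormal (W : H →ₗᵢ[ℝ] Lp ℝ 2 Q) : Prop :=
  ∀ h, HasLaw (W h) (gaussianReal 0 (‖h‖₊ ^ 2)) Q

namespace IsIsonormal

variable {W : H →ₗᵢ[ℝ] Lp ℝ 2 Q}

lemma integral_eq_zero (hW : IsIsonormal W) (h : H) : ∫ o, W h o ∂Q = 0 := by
  rw [(hW h).integral_eq, integral_id_gaussianReal]

lemma isGaussianProcess (hW : IsIsonormal W) : IsGaussianProcess (fun h => W h) Q := by
  classical
  refine ⟨fun I => ⟨isGaussian_of_map_eq_gaussianReal fun L => ?_⟩⟩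
  let c (j : I) : ℝ := L (Pi.single j 1)
  have hL (x : I → ℝ) : L x = ∑ j, c j * x j := by
    simp_rw [c, mul_comm _ (x _), ← smul_eq_mul, ← map_smul, ← map_sum]
    congr 1
    ext i
    simp [Finset.sum_apply, Pi.single_apply]
  have hlaw : HasLaw (fun o => L (I.restrict fun h => W h o))
      (gaussianReal 0 (‖∑ j, c j • (j : H)‖₊ ^ 2)) Q := by
    refine (hW _).congr ?_
    simp_rw [hL, map_sum, map_smul]
    exact ae_eq_coeFn_sum_smul Finset.univ c fun j => W j
  have hmeas : AEMeasurable (fun o => I.restrict fun h => W h o) Q :=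
    aemeasurable_pi_lambda _ fun j => aemeasurable_coeFn_Lp (W j)
  exact ⟨_, _, (AEMeasurable.map_map_of_aemeasurable (by fun_prop) hmeas).trans hlaw.map_eq⟩

end IsIsonormal

variable [IsProbabilityMeasure Q]

lemma inner_eq_covariance {f : Lp ℝ 2 Q} (hf : ∫ o, f o ∂Q = 0) (g : Lp ℝ 2 Q) :
    inner ℝ f g = cov[f, g; Q] := by
  rw [covariance_eq_sub (Lp.memLp f) (Lp.memLp g), hf, zero_mul, sub_zero, L2.inner_def]
  exact integral_congr_ae (ae_of_all _ fun o => mul_comm _ _)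

lemma norm_sq_eq_variance {f : Lp ℝ 2 Q} (hf : ∫ o, f o ∂Q = 0) : ‖f‖ ^ 2 = Var[f; Q] := by
  rw [← real_inner_self_eq_norm_sq, inner_eq_covariance hf,
    covariance_self (aemeasurable_coeFn_Lp f)]

lemma hasLaw_gaussianReal_nnnorm_sq {f : Lp ℝ 2 Q} (hf : HasGaussianLaw f Q)
    (hf₀ : ∫ o, f o ∂Q = 0) : HasLaw f (gaussianReal 0 (‖f‖₊ ^ 2)) Q := by
  refine ⟨hf.aemeasurable, ?_⟩
  rw [hf.map_eq_gaussianReal, hf₀, ← norm_sq_eq_variance hf₀, Real.toNNReal_pow (norm_nonneg _),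
    norm_toNNReal]

lemma isClosed_setOf_hasLaw_gaussianReal :
    IsClosed {f : Lp ℝ 2 Q | HasLaw f (gaussianReal 0 (‖f‖₊ ^ 2)) Q} := by
  refine IsSeqClosed.isClosed fun f g hf hfg => ⟨aemeasurable_coeFn_Lp g, ?_⟩
  have := Measure.isProbabilityMeasure_map (aemeasurable_coeFn_Lp g)
  refine Measure.ext_of_charFun (funext fun u => ?_)
  have hlim : Tendsto (fun n => charFun (gaussianReal 0 (‖f n‖₊ ^ 2)) u) atTop
      (𝓝 (charFun (Q.map g) u)) := by
    have hdistr := (tendstoInMeasure_of_tendsto_Lp hfg).tendstoInDistribution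
      fun n => aemeasurable_coeFn_Lp (f n)
    simpa only [ProbabilityMeasure.coe_mk, (hf _).map_eq] using
      ProbabilityMeasure.tendsto_iff_tendsto_charFun.1 hdistr.tendsto u
  have hcont : Continuous fun f : Lp ℝ 2 Q => charFun (gaussianReal 0 (‖f‖₊ ^ 2)) u := by
    simp only [charFun_gaussianReal]
    fun_prop
  exact tendsto_nhds_unique hlim ((hcont.tendsto g).comp hfg)

namespace IsIsonormal

variable {W : H →ₗᵢ[ℝ] Lp ℝ 2 Q}

lemma covariance_eq_inner (hW : IsIsonormal W) (h h' : H) :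
    cov[W h, W h'; Q] = inner ℝ h h' := by
  rw [← inner_eq_covariance (hW.integral_eq_zero h), W.inner_map_map]

end IsIsonormal

section Independent

variable {ι : Type*} {ξ : ι → Lp ℝ 2 Q}

lemma orthonormal_of_iIndepFun_gaussianReal (hξ : ∀ i, HasLaw (ξ i) (gaussianReal 0 1) Q)
    (hind : iIndepFun (fun i => ⇑(ξ i)) Q) : Orthonormal ℝ ξ := by
  have hmean (i : ι) : ∫ o, ξ i o ∂Q = 0 := by
    rw [(hξ i).integral_eq, integral_id_gaussianReal]
  refine ⟨fun i => ?_, fun i j hij => ?_⟩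
  · rw [← pow_eq_one_iff_of_nonneg (norm_nonneg _) two_ne_zero, norm_sq_eq_variance (hmean i),
      (hξ i).variance_eq, variance_id_gaussianReal, NNReal.coe_one]
  · change inner ℝ (ξ i) (ξ j) = 0
    rw [inner_eq_covariance (hmean i)]
    exact (hind.indepFun hij).covariance_eq_zero (Lp.memLp _) (Lp.memLp _)

lemma isIsonormal_of_iIndepFun (b : HilbertBasis ι ℝ H) {W : H →ₗᵢ[ℝ] Lp ℝ 2 Q}
    (hlaw : ∀ i, HasLaw (W (b i)) (gaussianReal 0 1) Q)
    (hind : iIndepFun (fun i => ⇑(W (b i))) Q) : IsIsonormal W := by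
  intro h
  have hclosed : IsClosed {h : H | HasLaw (W h) (gaussianReal 0 (‖h‖₊ ^ 2)) Q} := by
    simpa only [Set.preimage_ofPred_eq, W.nnnorm_map] using
      isClosed_setOf_hasLaw_gaussianReal.preimage W.continuous
  refine hclosed.mem_of_tendsto (b.hasSum_repr h) (Eventually.of_forall fun s => ?_)
  have hae := ae_eq_coeFn_sum_smul s (b.repr h) fun i => W (b i)
  simp_rw [← map_smul, ← map_sum] at hae
  have hgauss : HasGaussianLaw (W (∑ i ∈ s, b.repr h i • b i)) Q :=
    (((isGaussianProcess_of_iIndepFun (fun i => (hlaw i).hasGaussianLaw) hind).smul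
      (b.repr h)).hasGaussianLaw_fun_sum (I := s)).congr hae
  have hmean : ∫ o, W (∑ i ∈ s, b.repr h i • b i) o ∂Q = 0 := by
    rw [← integral_congr_ae hae,
      integral_finsetSum _ fun i _ => ((hlaw i).hasGaussianLaw.integrable).const_mul _]
    simp_rw [integral_const_mul, (hlaw _).integral_eq, integral_id_gaussianReal, mul_zero,
      Finset.sum_const_zero]
  simpa only [Set.mem_ofPred_eq, W.nnnorm_map] using hasLaw_gaussianReal_nnnorm_sq hgauss hmean

end Independent

theorem exists_isIsonormal (H : Type u) [NormedAddCommGroup H] [InnerProductSpace ℝ H]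
    [CompleteSpace H] :
    ∃ (Ω : Type u) (_ : MeasurableSpace Ω) (Q : Measure Ω) (_ : IsProbabilityMeasure Q)
      (W : H →ₗᵢ[ℝ] Lp ℝ 2 Q), IsIsonormal W := by
  classical
  obtain ⟨ι, b, -⟩ := exists_hilbertBasis ℝ H
  let Q : Measure (ι → ℝ) := Measure.infinitePi fun _ => gaussianReal 0 1
  have heval (i : ι) : HasLaw (fun x : ι → ℝ => x i) (gaussianReal 0 1) Q :=
    (measurePreserving_eval_infinitePi (fun _ : ι => gaussianReal 0 1) i).hasLaw
  have hmem (i : ι) : MemLp (fun x : ι → ℝ => x i) 2 Q := (heval i).hasGaussianLaw.memLp_two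
  let ξ (i : ι) : Lp ℝ 2 Q := (hmem i).toLp
  have hξ (i : ι) : HasLaw (ξ i) (gaussianReal 0 1) Q := (heval i).congr (hmem i).coeFn_toLp
  have hind : iIndepFun (fun i => ⇑(ξ i)) Q :=
    (iIndepFun_infinitePi (X := fun _ x => x) fun _ => measurable_id).congr
      fun i => (hmem i).coeFn_toLp.symm
  let W : H →ₗᵢ[ℝ] Lp ℝ 2 Q :=
    (orthonormal_of_iIndepFun_gaussianReal hξ hind).orthogonalFamily.linearIsometry.comp
      b.repr.toLinearIsometry
  have hWb (i : ι) : W (b i) = ξ i := by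
    simp [W, b.repr_self, OrthogonalFamily.linearIsometry_apply_single]
  refine ⟨ι → ℝ, inferInstance, Q, inferInstance, W, isIsonormal_of_iIndepFun b ?_ ?_⟩
  · simpa only [hWb] using hξ
  · simpa only [hWb] using hind

theorem exists_isGaussianProcess_covariance_eq {S : Type u} [MeasurableSpace S] {ν : Measure S}
    [IsProbabilityMeasure ν] {T : Type*} {f : T → S → ℝ} (hf : ∀ t, MemLp (f t) 2 ν) :
    ∃ (Ω : Type u) (_ : MeasurableSpace Ω) (Q : Measure Ω) (_ : IsProbabilityMeasure Q)
      (G : T → Ω → ℝ), IsGaussianProcess G Q ∧ (∀ t, ∫ o, G t o ∂Q = 0) ∧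
        ∀ t t', cov[G t, G t'; Q] = cov[f t, f t'; ν] := by
  obtain ⟨Ω, mΩ, Q, hQ, W, hW⟩ := exists_isIsonormal (Lp ℝ 2 ν)
  have hcentred (t : T) : MemLp (fun z => f t z - ∫ z', f t z' ∂ν) 2 ν :=
    (hf t).sub (memLp_const _)
  let g (t : T) : Lp ℝ 2 ν := (hcentred t).toLp
  refine ⟨Ω, mΩ, Q, hQ, fun t => W (g t), hW.isGaussianProcess.comp_right g,
    fun t => hW.integral_eq_zero (g t), fun t t' => ?_⟩
  rw [hW.covariance_eq_inner, L2.inner_def]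
  refine integral_congr_ae ?_
  filter_upwards [(hcentred t).coeFn_toLp, (hcentred t').coeFn_toLp] with z hz hz'
  rw [hz, hz']
  exact mul_comm _ _

end Isonormal

section CentralLimit

variable {Ω Ω' : Type*} {mΩ : MeasurableSpace Ω} {mΩ' : MeasurableSpace Ω'}
  {P : Measure Ω} {Q : Measure Ω'}

lemma charFun_map_toLp {ι : Type*} [Fintype ι] {X : Ω → ι → ℝ} (hX : AEMeasurable X P)
    (c : EuclideanSpace ℝ ι) :
    charFun (P.map (fun o => WithLp.toLp 2 (X o))) c =
      charFun (P.map (fun o => ∑ j, c j * X o j)) 1 := by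
  rw [charFun_apply, charFun_apply_real, integral_map (by fun_prop)
    (by exact AEMeasurable.aestronglyMeasurable (by fun_prop)), integral_map (by fun_prop)
    (by exact AEMeasurable.aestronglyMeasurable (by fun_prop))]
  simp [PiLp.inner_apply]

lemma variance_fun_sum_const_mul [IsFiniteMeasure P] {ι : Type*} [Fintype ι] {X : ι → Ω → ℝ}
    (hX : ∀ j, MemLp (X j) 2 P) (c : ι → ℝ) :
    Var[fun o => ∑ j, c j * X j o; P] = ∑ i, ∑ j, c i * (c j * cov[X i, X j; P]) := by
  simp_rw [variance_fun_sum fun j => (hX j).const_mul (c j), covariance_const_mul_left,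
    covariance_const_mul_right]

lemma hasLaw_fun_sum_const_mul_of_isGaussianProcess {ι : Type*} [Fintype ι] {G : ι → Ω → ℝ}
    (hG : IsGaussianProcess G P) (hmean : ∀ j, ∫ o, G j o ∂P = 0) (c : ι → ℝ) :
    HasLaw (fun o => ∑ j, c j * G j o)
      (gaussianReal 0 Var[fun o => ∑ j, c j * G j o; P].toNNReal) P := by
  have hgauss : HasGaussianLaw (fun o => ∑ j, c j * G j o) P :=
    (hG.smul c).hasGaussianLaw_fun_sum (I := Finset.univ)
  have hmean_sum : ∫ o, ∑ j, c j * G j o ∂P = 0 := by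
    rw [integral_finsetSum _ fun j _ => (hG.hasGaussianLaw_eval j).integrable.const_mul _]
    simp_rw [integral_const_mul, hmean, mul_zero, Finset.sum_const_zero]
  exact ⟨hgauss.aemeasurable, by rw [hgauss.map_eq_gaussianReal, hmean_sum]⟩

variable [IsProbabilityMeasure P] [IsProbabilityMeasure Q]

theorem tendstoInDistribution_pi_of_forall_sum_mul {ι : Type*} [Fintype ι]
    {X : ℕ → Ω → ι → ℝ} {Y : Ω' → ι → ℝ}
    (hX : ∀ n, AEMeasurable (X n) P) (hY : AEMeasurable Y Q)
    (h : ∀ c : ι → ℝ, TendstoInDistribution (fun n o => ∑ j, c j * X n o j) atTop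
      (fun o => ∑ j, c j * Y o j) (fun _ => P) Q) :
    TendstoInDistribution X atTop Y (fun _ => P) Q := by
  have htoLp : TendstoInDistribution (fun n o => WithLp.toLp 2 (X n o)) atTop
      (fun o => WithLp.toLp 2 (Y o)) (fun _ => P) Q := by
    refine ⟨fun n => by have := hX n; fun_prop, by fun_prop,
      ProbabilityMeasure.tendsto_iff_tendsto_charFun.2 fun c => ?_⟩
    have hc := ProbabilityMeasure.tendsto_iff_tendsto_charFun.1 (h c).tendsto 1
    simp only [ProbabilityMeasure.coe_mk] at hc ⊢
    rw [charFun_map_toLp hY]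
    simpa only [charFun_map_toLp (hX _)] using hc
  exact htoLp.continuous_comp (g := WithLp.ofLp) (by fun_prop)

section Iid

variable {S : Type*} [MeasurableSpace S] {ν : Measure S} {Z : ℕ → Ω → S}

lemma tendstoInDistribution_sqrt_mul_mean_sub (hZ : ∀ i, HasLaw (Z i) ν P) (hind : iIndepFun Z P)
    {F : S → ℝ} (hF : Measurable F) (hF₂ : MemLp F 2 ν) {Y : Ω' → ℝ}
    (hY : HasLaw Y (gaussianReal 0 Var[F; ν].toNNReal) Q) :
    TendstoInDistribution
      (fun (n : ℕ) o => √(n : ℝ) * ((∑ i ∈ Finset.range n, F (Z i o)) / n - ∫ z, F z ∂ν))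
      atTop Y (fun _ => P) Q := by
  have hlaw (i : ℕ) : HasLaw (F ∘ Z i) (ν.map F) P :=
    HasLaw.comp ⟨hF.aemeasurable, rfl⟩ (hZ i)
  have hvar : Var[F ∘ Z 0; P] = Var[F; ν] := by
    rw [← covariance_self (hlaw 0).aemeasurable,
      (hZ 0).covariance_comp hF.aemeasurable hF.aemeasurable, covariance_self hF.aemeasurable]
  have hmem : MemLp (F ∘ Z 0) 2 P :=
    MemLp.comp_of_map ((hZ 0).map_eq ▸ hF₂) (hZ 0).aemeasurable
  have hclt := tendstoInDistribution_inv_sqrt_mul_sum_sub (X := fun i => F ∘ Z i)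
    (hvar ▸ hY) hmem (hind.comp (fun _ => F) fun _ => hF)
    fun i => (hlaw i).identDistrib (hlaw 0)
  convert! hclt using 3 with n o
  rw [(hZ 0).integral_comp hF.aestronglyMeasurable]
  rcases eq_or_ne n 0 with rfl | hn
  · simp
  · have hn₀ : (n : ℝ) ≠ 0 := Nat.cast_ne_zero.2 hn
    have hsqrt : (√(n : ℝ))⁻¹ * n = √(n : ℝ) := by rw [inv_mul_eq_div, Real.div_sqrt]
    nth_rw 1 [← hsqrt]
    rw [mul_assoc, mul_sub, mul_div_cancel₀ _ hn₀]
    rfl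

theorem tendstoInDistribution_sqrt_mul_mean_sub_pi (hZ : ∀ i, HasLaw (Z i) ν P)
    (hind : iIndepFun Z P) {ι : Type*} [Finite ι] {f : ι → S → ℝ}
    (hf : ∀ j, Measurable (f j)) (hf₂ : ∀ j, MemLp (f j) 2 ν)
    {G : ι → Ω' → ℝ} (hG : IsGaussianProcess G Q) (hmean : ∀ j, ∫ o, G j o ∂Q = 0)
    (hcov : ∀ i j, cov[G i, G j; Q] = cov[f i, f j; ν]) :
    TendstoInDistribution
      (fun (n : ℕ) o j =>
        √(n : ℝ) * ((∑ i ∈ Finset.range n, f j (Z i o)) / n - ∫ z, f j z ∂ν))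
      atTop (fun o j => G j o) (fun _ => P) Q := by
  have : IsProbabilityMeasure ν := (hZ 0).isProbabilityMeasure_iff.1 inferInstance
  have : Fintype ι := Fintype.ofFinite ι
  have hfZ (j : ι) (i : ℕ) : AEMeasurable (fun o => f j (Z i o)) P :=
    (hf j).comp_aemeasurable (hZ i).aemeasurable
  refine tendstoInDistribution_pi_of_forall_sum_mul
    (fun n => aemeasurable_pi_lambda _ fun j => (((Finset.aemeasurable_fun_sum _ fun i _ =>
      hfZ j i).div_const _).sub_const _).const_mul _)
    (aemeasurable_pi_lambda _ hG.aemeasurable) fun c => ?_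
  let F : S → ℝ := fun z => ∑ j, c j * f j z
  have hF : Measurable F := Finset.measurable_fun_sum _ fun j _ => (hf j).const_mul _
  have hF₂ : MemLp F 2 ν := memLp_finsetSum _ fun j _ => (hf₂ j).const_mul _
  have hvar : Var[fun o => ∑ j, c j * G j o; Q] = Var[F; ν] := by
    rw [variance_fun_sum_const_mul (fun j => (hG.hasGaussianLaw_eval j).memLp_two),
      variance_fun_sum_const_mul hf₂]
    simp_rw [hcov]
  have hclt := tendstoInDistribution_sqrt_mul_mean_sub hZ hind hF hF₂
    (hvar ▸ hasLaw_fun_sum_const_mul_of_isGaussianProcess hG hmean c)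
  convert! hclt using 3 with n o
  have hint : ∫ z, F z ∂ν = ∑ j, c j * ∫ z, f j z ∂ν := by
    rw [integral_finsetSum _ fun j _ => ((hf₂ j).integrable one_le_two).const_mul _]
    simp_rw [integral_const_mul]
  have hsum : ∑ i ∈ Finset.range n, F (Z i o) =
      ∑ j, c j * ∑ i ∈ Finset.range n, f j (Z i o) := by
    simp_rw [F, Finset.mul_sum]
    exact Finset.sum_comm
  rw [hint, hsum, Finset.sum_div, ← Finset.sum_sub_distrib, Finset.mul_sum]
  exact Finset.sum_congr rfl fun j _ => by ring

end Iid

theorem convergesToGP_of_iid {S : Type} [MeasurableSpace S] {ν : Measure S} {Z : ℕ → Ω → S}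
    (hZ : ∀ i, HasLaw (Z i) ν P) (hind : iIndepFun Z P) {T : Set ℝ} {f : ℝ → S → ℝ}
    (hf : ∀ t, Measurable (f t)) (hf₂ : ∀ t ∈ T, MemLp (f t) 2 ν)
    {m : ℝ → ℝ} {K : ℝ → ℝ → ℝ} (hm : ∀ t ∈ T, ∫ z, f t z ∂ν = m t)
    (hK : ∀ t ∈ T, ∀ t' ∈ T, cov[f t, f t'; ν] = K t t') :
    ConvergesToGP P T
      (fun n t o => √(n : ℝ) * ((∑ i ∈ Finset.range n, f t (Z i o)) / n - m t)) K := by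
  have : IsProbabilityMeasure ν := (hZ 0).isProbabilityMeasure_iff.1 inferInstance
  obtain ⟨Ω', mΩ', Q, hQ, G, hG, hmean, hcov⟩ :=
    exists_isGaussianProcess_covariance_eq (f := fun t : T => f t) fun t => hf₂ t t.2
  refine ⟨Ω', mΩ', Q, hQ, G, hG, hmean, fun t t' => (hcov t t').trans (hK t t.2 t' t'.2),
    fun k t => ?_⟩
  simpa only [hm _ (t _).2] using tendstoInDistribution_sqrt_mul_mean_sub_pi hZ hind
    (fun j => hf (t j)) (fun j => hf₂ (t j) (t j).2) (G := fun j => G (t j))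
    (hG.comp_right t) (fun j => hmean (t j))
    fun i j => hcov (t i) (t j)

end CentralLimit

section Cauchy

lemma integrable_exp_neg_mul_abs {γ : ℝ} (hγ : 0 < γ) :
    Integrable fun x : ℝ => Real.exp (-(γ * |x|)) := by
  have hpos : IntegrableOn (fun x : ℝ => Real.exp (-(γ * |x|))) (Set.Ioi 0) :=
    (integrableOn_exp_mul_Ioi (neg_lt_zero.2 hγ) 0).congr_fun
      (fun x hx => by simp only [abs_of_pos hx.out, neg_mul]) measurableSet_Ioi
  have hneg : IntegrableOn (fun x : ℝ => Real.exp (-(γ * |x|))) (Set.Iic 0) :=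
    (integrableOn_exp_mul_Iic hγ 0).congr_fun
      (fun x hx => by simp only [abs_of_nonpos hx.out, mul_neg, neg_neg]) measurableSet_Iic
  rw [← integrableOn_univ, ← Set.Iic_union_Ioi (a := (0 : ℝ))]
  exact hneg.union hpos

open Complex in
lemma integral_cexp_mul_exp_neg_mul_abs {γ : ℝ} (hγ : 0 < γ) (u : ℝ) :
    ∫ x : ℝ, cexp (u * x * I) * Real.exp (-(γ * |x|)) = 2 * γ / (γ ^ 2 + u ^ 2) := by
  have ha : 0 < (γ + u * I).re := by simpa using hγ
  have hb : (-γ + u * I).re < 0 := by simpa using hγ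
  have hle : Set.EqOn (fun x : ℝ => cexp (u * x * I) * Real.exp (-(γ * |x|)))
      (fun x => cexp ((γ + u * I) * x)) (Set.Iic 0) := by
    intro x hx
    simp only [abs_of_nonpos hx.out, ofReal_exp, ← Complex.exp_add]
    push_cast
    ring_nf
  have hgt : Set.EqOn (fun x : ℝ => cexp (u * x * I) * Real.exp (-(γ * |x|)))
      (fun x => cexp ((-γ + u * I) * x)) (Set.Ioi 0) := by
    intro x hx
    simp only [abs_of_pos hx.out, ofReal_exp, ← Complex.exp_add]
    push_cast
    ring_nf
  have hint_le := (integrableOn_exp_mul_complex_Iic ha 0).congr_fun hle.symm measurableSet_Iic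
  have hint_gt := (integrableOn_exp_mul_complex_Ioi hb 0).congr_fun hgt.symm measurableSet_Ioi
  rw [← intervalIntegral.integral_Iic_add_Ioi hint_le hint_gt,
    setIntegral_congr_fun measurableSet_Iic hle, setIntegral_congr_fun measurableSet_Ioi hgt,
    integral_exp_mul_complex_Iic ha, integral_exp_mul_complex_Ioi hb]
  have ha₀ : (γ + u * I) ≠ 0 := fun h => by simp [h] at ha
  have hb₀ : (-γ + u * I) ≠ 0 := fun h => by simp [h] at hb
  have hprod : (γ : ℂ) ^ 2 + u ^ 2 = -((γ + u * I) * (-γ + u * I)) := by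
    linear_combination (u : ℂ) ^ 2 * I_sq
  rw [hprod, ofReal_zero, mul_zero, mul_zero, Complex.exp_zero]
  field_simp
  ring

lemma fourier_exp_neg_mul_abs {γ : ℝ≥0} (hγ : γ ≠ 0) (ξ : ℝ) :
    𝓕 (fun x : ℝ => (Real.exp (-(γ * |x|)) : ℂ)) ξ =
      ((2 * Real.pi * cauchyPDFReal 0 γ (2 * Real.pi * ξ) : ℝ) : ℂ) := by
  have hint := integral_cexp_mul_exp_neg_mul_abs (NNReal.coe_pos.2 hγ.bot_lt) (-2 * Real.pi * ξ)
  simp only [Real.fourier_real_eq_integral_exp_smul, smul_eq_mul, ← Complex.ofReal_mul,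
    mul_right_comm _ ξ] at hint ⊢
  rw [hint, cauchyPDFReal_def]
  push_cast
  field_simp
  ring

lemma integral_cexp_mul_cauchyPDFReal {γ : ℝ≥0} (hγ : γ ≠ 0) (t : ℝ) :
    ∫ w, Complex.exp (↑(w * t) * Complex.I) * cauchyPDFReal 0 γ w =
      Real.exp (-(γ * |t|)) := by
  have hπ : 0 < 2 * Real.pi := Real.two_pi_pos
  let f : ℝ → ℂ := fun x => (Real.exp (-(γ * |x|)) : ℂ)
  have hf : Integrable f := (integrable_exp_neg_mul_abs (NNReal.coe_pos.2 hγ.bot_lt)).ofReal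
  have hFf : Integrable (𝓕 f) := by
    simp only [f, funext (fourier_exp_neg_mul_abs hγ)]
    exact (((integrable_cauchyPDFReal 0).comp_mul_left' hπ.ne').const_mul _).ofReal
  have hinv := congrFun ((by fun_prop : Continuous f).fourierInv_fourier_eq hf hFf) t
  rw [Real.fourierInv_eq'] at hinv
  have hscale := Measure.integral_comp_mul_left (fun w : ℝ =>
    Complex.exp (↑(w * t) * Complex.I) * cauchyPDFReal 0 γ w) (2 * Real.pi)
  rw [abs_of_pos (inv_pos.2 hπ), eq_inv_smul_iff₀ hπ.ne', ← integral_smul] at hscale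
  rw [← hscale]
  refine Eq.trans (integral_congr_ae (ae_of_all _ fun ξ => ?_)) hinv
  simp only [f, fourier_exp_neg_mul_abs hγ, Complex.real_smul, smul_eq_mul,
    RCLike.inner_apply, conj_trivial]
  push_cast
  ring_nf

lemma integral_cos_mul_cauchyPDFReal {γ : ℝ≥0} (hγ : γ ≠ 0) (t : ℝ) :
    ∫ w, Real.cos (w * t) * cauchyPDFReal 0 γ w = Real.exp (-(γ * |t|)) := by
  have hint : Integrable fun w : ℝ =>
      Complex.exp (↑(w * t) * Complex.I) * cauchyPDFReal 0 γ w :=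
    (integrable_cauchyPDFReal 0).ofReal.bdd_mul (c := 1) (by fun_prop)
      (ae_of_all _ fun w => (Complex.norm_exp_ofReal_mul_I _).le)
  have hre := congrArg Complex.re (integral_cexp_mul_cauchyPDFReal hγ t)
  rw [Complex.ofReal_re, ← RCLike.re_to_complex, ← integral_re hint] at hre
  simpa only [RCLike.re_to_complex, Complex.re_mul_ofReal, Complex.exp_ofReal_mul_I_re] using hre

section Mixture

variable {α : Type*} [MeasurableSpace α] {μ : Measure α} [SFinite μ] {γ : α → ℝ≥0}

lemma integrable_uncurry_mul_cauchyPDFReal (hγ : Measurable γ) (hγ₀ : ∀ᵐ x ∂μ, γ x ≠ 0)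
    {g : α → ℝ} (hg : Integrable g μ) :
    Integrable (Function.uncurry fun (w : ℝ) x => g x * cauchyPDFReal 0 (γ x) w)
      (volume.prod μ) := by
  have hpdf : Measurable fun p : ℝ × α => cauchyPDFReal 0 (γ p.2) p.1 := by
    unfold cauchyPDFReal
    fun_prop
  refine (integrable_prod_iff' (hg.1.comp_snd.mul hpdf.aestronglyMeasurable)).2
    ⟨ae_of_all _ fun x => (integrable_cauchyPDFReal 0 (γ := γ x)).const_mul (g x), hg.norm.congr ?_⟩
  filter_upwards [hγ₀] with x hx
  simp only [Pi.mul_apply, norm_mul, integral_const_mul,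
    Real.norm_of_nonneg (cauchyPDF_pos 0 hx _).le, integral_cauchyPDFReal_eq_one 0 hx, mul_one]

lemma integral_integral_mul_cos_mul_cauchyPDFReal (hγ : Measurable γ)
    (hγ₀ : ∀ᵐ x ∂μ, γ x ≠ 0) {g : α → ℝ} (hg : Integrable g μ) (t : ℝ) :
    ∫ w, ∫ x, g x * Real.cos (w * t) * cauchyPDFReal 0 (γ x) w ∂μ =
      ∫ x, g x * Real.exp (-(γ x * |t|)) ∂μ := by
  have hint : Integrable (Function.uncurry fun (w : ℝ) x =>
      g x * Real.cos (w * t) * cauchyPDFReal 0 (γ x) w) (volume.prod μ) := by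
    refine ((integrable_uncurry_mul_cauchyPDFReal hγ hγ₀ hg).bdd_mul (c := 1)
      (f := fun p => Real.cos (p.1 * t)) (by fun_prop)
      (ae_of_all _ fun p => Real.abs_cos_le_one _)).congr (ae_of_all _ fun p => ?_)
    simp only [Function.uncurry]
    ring
  rw [integral_integral_swap hint]
  refine integral_congr_ae ?_
  filter_upwards [hγ₀] with x hx
  simp_rw [mul_assoc, integral_const_mul, integral_cos_mul_cauchyPDFReal hx]

end Mixture

lemma cauchyUniform_eq_mul_indicator (a b : ℝ) {x : ℝ} (hx : 0 ≤ x) (ω : ℝ) :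
    cauchyUniform a b x ω =
      cauchyPDFReal 0 (x / 2).toNNReal ω * (Set.Icc a b).indicator (fun _ => 1 / (b - a)) x := by
  rw [cauchyUniform, cauchyPDFReal_def, Real.coe_toNNReal _ (by positivity), sub_zero,
    mul_comm Real.pi, div_mul_eq_div_div]
  ring

lemma integral_integral_mul_cos_mul_cauchyUniform {a b : ℝ} (ha : 0 < a) (hab : a ≤ b)
    {g : ℝ → ℝ} (hg : Continuous g) (t : ℝ) :
    ∫ w : ℝ, ∫ x in Set.Ioi 0, g x * Real.cos (w * t) * cauchyUniform a b x w =
      (∫ x in a..b, g x * Real.exp (-(x / 2 * |t|))) / (b - a) := by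
  have hpos : Set.Icc a b ⊆ Set.Ioi 0 := fun x hx => ha.trans_le hx.1
  have hinner (w : ℝ) :
      ∫ x in Set.Ioi 0, g x * Real.cos (w * t) * cauchyUniform a b x w =
        ∫ x in Set.Icc a b,
          g x / (b - a) * Real.cos (w * t) * cauchyPDFReal 0 (x / 2).toNNReal w := by
    rw [← Set.inter_eq_self_of_subset_right hpos, ← setIntegral_indicator measurableSet_Icc]
    refine setIntegral_congr_fun measurableSet_Ioi fun x hx => ?_
    simp only [cauchyUniform_eq_mul_indicator a b (le_of_lt hx), Set.indicator]
    split_ifs <;> ring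
  have hscale : ∀ᵐ x ∂volume.restrict (Set.Icc a b), (x / 2).toNNReal ≠ 0 := by
    filter_upwards [ae_restrict_mem measurableSet_Icc] with x hx
    exact (Real.toNNReal_pos.2 (half_pos (hpos hx))).ne'
  simp_rw [hinner]
  rw [integral_integral_mul_cos_mul_cauchyPDFReal (by fun_prop) hscale
    ((by fun_prop : Continuous fun x => g x / (b - a)).integrableOn_Icc),
    intervalIntegral.integral_of_le hab, ← integral_Icc_eq_integral_Ioc, ← integral_div]
  refine setIntegral_congr_fun measurableSet_Icc fun x hx => ?_
  have hcoe : ((x / 2).toNNReal : ℝ) = x / 2 := Real.coe_toNNReal _ (half_pos (hpos hx)).le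
  simp only [hcoe]
  ring

section ExpMoments

variable {τ : ℝ} (hτ : τ ≠ 0) (a b : ℝ)

include hτ

lemma integral_id_mul_exp_neg_mul :
    ∫ x in a..b, x * Real.exp (-(x * τ)) =
      ((1 + a * τ) * Real.exp (-(a * τ)) - Real.exp (-(b * τ)) * (1 + b * τ)) / τ ^ 2 := by
  have hderiv (x : ℝ) : HasDerivAt (fun x => -((1 + x * τ) * Real.exp (-(x * τ)) / τ ^ 2))
      (x * Real.exp (-(x * τ))) x := by
    have hlin : HasDerivAt (fun x => x * τ) τ x := hasDerivAt_mul_const τ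
    convert! (((hlin.const_add 1).mul hlin.neg.exp).div_const (τ ^ 2)).neg using 1
    simp only [Pi.neg_apply]
    field_simp
    ring
  rw [intervalIntegral.integral_eq_sub_of_hasDerivAt (fun x _ => hderiv x)
    (by exact Continuous.intervalIntegrable (by fun_prop) _ _)]
  ring

lemma integral_sq_mul_exp_neg_mul :
    ∫ x in a..b, x ^ 2 * Real.exp (-(x * τ)) =
      2 * ((1 + a * τ + a ^ 2 * τ ^ 2 / 2) * Real.exp (-(a * τ)) -
        Real.exp (-(b * τ)) * (1 + b * τ + b ^ 2 * τ ^ 2 / 2)) / τ ^ 3 := by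
  have hderiv (x : ℝ) : HasDerivAt
      (fun x => -(2 * ((1 + x * τ + (x * τ) ^ 2 / 2) * Real.exp (-(x * τ))) / τ ^ 3))
      (x ^ 2 * Real.exp (-(x * τ))) x := by
    have hlin : HasDerivAt (fun x => x * τ) τ x := hasDerivAt_mul_const τ
    convert! (((((hlin.const_add 1).add ((hlin.pow 2).div_const 2)).mul
      hlin.neg.exp).const_mul 2).div_const (τ ^ 3)).neg using 1
    simp only [Pi.add_apply, Pi.pow_apply, Pi.neg_apply]
    field_simp
    ring
  rw [intervalIntegral.integral_eq_sub_of_hasDerivAt (fun x _ => hderiv x)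
    (by exact Continuous.intervalIntegrable (by fun_prop) _ _)]
  ring

end ExpMoments

lemma max_eq_half_add_add_abs_sub (s t : ℝ) : max s t = (s + t + |s - t|) / 2 := by
  rw [← max_sub_min_eq_abs', ← max_add_min s t]
  ring

theorem muH_cauchyUniform (κ : ℝ) {a_m a_M : ℝ} (ha : 0 < a_m) (haM : a_m ≤ a_M) {t : ℝ}
    (ht : 0 < t) :
    muH κ (cauchyUniform a_m a_M) t =
      -(r₁ κ / √2) *
        (((1 + a_m * t) * Real.exp (-(a_m * t)) - Real.exp (-(a_M * t)) * (1 + a_M * t)) /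
          (t ^ 2 * (a_M - a_m))) := by
  have hexp (x : ℝ) : x * Real.exp (-(x * t / 2)) * Real.exp (-(x / 2 * |t|)) =
      x * Real.exp (-(x * t)) := by
    rw [mul_assoc, ← Real.exp_add, abs_of_pos ht]
    ring_nf
  rw [muH, integral_integral_mul_cos_mul_cauchyUniform ha haM
    (g := fun x => x * Real.exp (-(x * t / 2))) (by fun_prop) t]
  simp_rw [hexp]
  rw [integral_id_mul_exp_neg_mul ht.ne', div_mul_eq_div_div]

theorem limitKernel_cauchyUniform (κ : ℝ) {a_m a_M : ℝ} (ha : 0 < a_m) (haM : a_m ≤ a_M)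
    {t t' : ℝ} (hτ : max t t' ≠ 0) :
    limitKernel κ (cauchyUniform a_m a_M) t t' =
      1 / 2 * (2 * ((1 + a_m * max t t' + a_m ^ 2 * max t t' ^ 2 / 2) *
          Real.exp (-(a_m * max t t')) -
          Real.exp (-(a_M * max t t')) * (1 + a_M * max t t' + a_M ^ 2 * max t t' ^ 2 / 2)) /
          (max t t' ^ 3 * (a_M - a_m)))
        - muH κ (cauchyUniform a_m a_M) t * muH κ (cauchyUniform a_m a_M) t' := by
  have hexp (x : ℝ) :
      x ^ 2 * Real.exp (-(x * (t + t') / 2)) * Real.exp (-(x / 2 * |t - t'|)) =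
        x ^ 2 * Real.exp (-(x * max t t')) := by
    rw [mul_assoc, ← Real.exp_add, max_eq_half_add_add_abs_sub]
    ring_nf
  rw [limitKernel, integral_integral_mul_cos_mul_cauchyUniform ha haM
    (g := fun x => x ^ 2 * Real.exp (-(x * (t + t') / 2))) (by fun_prop) (t - t')]
  simp_rw [hexp]
  rw [integral_sq_mul_exp_neg_mul hτ, div_mul_eq_div_div]

end Cauchy

section Bessel

open Real intervalIntegral

lemma besselI_zero_nonneg (κ : ℝ) : 0 ≤ besselI 0 κ :=
  tsum_nonneg fun m => div_nonneg ((even_two_mul m).pow_nonneg _) (by positivity)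

lemma integral_cos_pow_add_two (n : ℕ) :
    ∫ θ in -π..π, cos θ ^ (n + 2) = (n + 1) / (n + 2) * ∫ θ in -π..π, cos θ ^ n := by
  simp [integral_cos_pow]

lemma integral_cos_pow_odd (m : ℕ) : ∫ θ in -π..π, cos θ ^ (2 * m + 1) = 0 := by
  induction m with
  | zero => simp
  | succ m ih => rw [mul_add_one, add_right_comm, integral_cos_pow_add_two, ih, mul_zero]

lemma integral_cos_pow_even (m : ℕ) :
    ∫ θ in -π..π, cos θ ^ (2 * m) =
      2 * π * ((2 * m).factorial / (4 ^ m * (m.factorial : ℝ) ^ 2)) := by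
  induction m with
  | zero =>
    simp only [mul_zero, pow_zero, intervalIntegral.integral_const, smul_eq_mul, Nat.factorial_zero,
      Nat.cast_one]
    ring
  | succ m ih =>
    rw [mul_add_one, integral_cos_pow_add_two, ih, Nat.factorial_succ m,
      Nat.factorial_succ (2 * m + 1), Nat.factorial_succ (2 * m)]
    push_cast
    field_simp
    ring

lemma hasSum_integral_cos_mul_exp_cos (κ : ℝ) :
    HasSum (fun n : ℕ => κ ^ n / n.factorial * ∫ θ in -π..π, cos θ ^ (n + 1))
      (∫ θ in -π..π, cos θ * exp (κ * cos θ)) := by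
  simp_rw [← intervalIntegral.integral_const_mul]
  refine hasSum_integral_of_dominated_convergence (fun n _ => |κ| ^ n / n.factorial)
    (fun n => by exact Continuous.aestronglyMeasurable (by fun_prop))
    (fun n => ae_of_all _ fun θ _ => ?_)
    (ae_of_all _ fun θ _ => Real.summable_pow_div_factorial |κ|) intervalIntegrable_const
    (ae_of_all _ fun θ _ => ?_)
  · rw [norm_mul, norm_div, norm_pow, norm_pow, Real.norm_natCast, norm_eq_abs, norm_eq_abs]
    exact mul_le_of_le_one_right (by positivity) (pow_le_one₀ (abs_nonneg _) (abs_cos_le_one _))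
  · have hexp := (NormedSpace.expSeries_div_hasSum_exp (κ * cos θ)).mul_left (cos θ)
    rw [← exp_eq_exp_ℝ] at hexp
    refine hexp.congr_fun fun n => ?_
    rw [mul_pow]
    ring

lemma integral_cos_mul_exp_cos (κ : ℝ) :
    ∫ θ in -π..π, cos θ * exp (κ * cos θ) = 2 * π * besselI 1 κ := by
  have hinj : Function.Injective fun m : ℕ => 2 * m + 1 := fun a b h => by simpa using h
  have heven (n : ℕ) (hn : n ∉ Set.range fun m : ℕ => 2 * m + 1) :
      κ ^ n / n.factorial * ∫ θ in -π..π, cos θ ^ (n + 1) = 0 := by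
    obtain ⟨m, rfl | rfl⟩ := n.even_or_odd'
    · rw [integral_cos_pow_odd, mul_zero]
    · exact absurd ⟨m, rfl⟩ hn
  have hterm (m : ℕ) : 2 * π * ((κ / 2) ^ (2 * m + 1) /
      ((m.factorial : ℝ) * ((m + 1).factorial : ℝ))) =
        κ ^ (2 * m + 1) / (2 * m + 1).factorial * ∫ θ in -π..π, cos θ ^ (2 * m + 1 + 1) := by
    rw [show 2 * m + 1 + 1 = 2 * (m + 1) by ring, integral_cos_pow_even,
      show 2 * (m + 1) = 2 * m + 1 + 1 by ring, Nat.factorial_succ (2 * m + 1),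
      Nat.factorial_succ m, div_pow, pow_succ 4, pow_succ 2, pow_mul 2]
    push_cast
    field_simp
    norm_num
    ring
  have hsum := ((hinj.hasSum_iff heven).2 (hasSum_integral_cos_mul_exp_cos κ)).congr_fun hterm
  rw [besselI, ← tsum_mul_left, hsum.tsum_eq]

end Bessel

section VonMises

open Real

/-- The density of the angle between a von Mises distributed point of the circle and its mean
direction. -/
noncomputable def vonMisesPDFReal (κ θ : ℝ) : ℝ := exp (κ * cos θ) / (2 * π * besselI 0 κ)

@[fun_prop]
lemma continuous_vonMisesPDFReal (κ : ℝ) : Continuous (vonMisesPDFReal κ) := by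
  unfold vonMisesPDFReal
  fun_prop

lemma vonMisesPDFReal_nonneg (κ θ : ℝ) : 0 ≤ vonMisesPDFReal κ θ := by
  have := besselI_zero_nonneg κ
  unfold vonMisesPDFReal
  positivity

lemma vonMisesPDFReal_neg (κ θ : ℝ) : vonMisesPDFReal κ (-θ) = vonMisesPDFReal κ θ := by
  rw [vonMisesPDFReal, cos_neg, vonMisesPDFReal]

lemma vonMisesPDFReal_periodic (κ : ℝ) : Function.Periodic (vonMisesPDFReal κ) (2 * π) :=
  fun θ => by rw [vonMisesPDFReal, cos_add_two_pi, vonMisesPDFReal]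

lemma integral_vonMisesPDFReal_mul_cos (κ : ℝ) :
    ∫ θ in -π..π, vonMisesPDFReal κ θ * cos θ = r₁ κ := by
  have hdiv (θ : ℝ) : vonMisesPDFReal κ θ * cos θ =
      cos θ * exp (κ * cos θ) / (2 * π * besselI 0 κ) := by
    rw [vonMisesPDFReal, div_mul_eq_mul_div, mul_comm (cos θ)]
  simp_rw [hdiv]
  rw [intervalIntegral.integral_div, integral_cos_mul_exp_cos,
    mul_div_mul_left _ _ (by positivity), r₁]

lemma integral_vonMisesPDFReal_mul_comp_neg (κ : ℝ) (h : ℝ → ℝ) :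
    ∫ θ in -π..π, vonMisesPDFReal κ θ * h (-θ) = ∫ θ in -π..π, vonMisesPDFReal κ θ * h θ := by
  have hcomp := intervalIntegral.integral_comp_neg (fun θ => vonMisesPDFReal κ θ * h θ)
    (a := -π) (b := π)
  simpa only [vonMisesPDFReal_neg, neg_neg] using hcomp

lemma integral_vonMisesPDFReal_mul_sin (κ : ℝ) :
    ∫ θ in -π..π, vonMisesPDFReal κ θ * sin θ = 0 := by
  have hneg := integral_vonMisesPDFReal_mul_comp_neg κ sin
  simp only [sin_neg, mul_neg, intervalIntegral.integral_neg] at hneg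
  linarith

lemma integral_vonMises (κ β : ℝ) {h : ℝ × ℝ → ℝ} (hh : Continuous h) :
    ∫ s, h s ∂vonMises (cos β, sin β) κ =
      ∫ θ in -π..π, vonMisesPDFReal κ θ * h (cos (θ + β), sin (θ + β)) := by
  have hdensity (θ : ℝ) : (ENNReal.ofReal (exp (κ * (cos β * cos θ + sin β * sin θ)) /
      (2 * π * besselI 0 κ))).toReal = vonMisesPDFReal κ (θ - β) := by
    rw [mul_comm (cos β), mul_comm (sin β), ← cos_sub]
    exact ENNReal.toReal_ofReal (vonMisesPDFReal_nonneg κ (θ - β))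
  have hperiodic : Function.Periodic
      (fun θ => vonMisesPDFReal κ θ * h (cos (θ + β), sin (θ + β))) (2 * π) := fun θ => by
    simp only [vonMisesPDFReal_periodic κ θ, add_right_comm θ, cos_add_two_pi, sin_add_two_pi]
  calc ∫ s, h s ∂vonMises (cos β, sin β) κ
    _ = ∫ θ in -π..π, vonMisesPDFReal κ (θ - β) * h (cos θ, sin θ) := by
      rw [vonMises, integral_withDensity_eq_integral_toReal_smul (by fun_prop)
        (ae_of_all _ fun _ => ENNReal.ofReal_lt_top), integral_map (by fun_prop)
        (by exact Measurable.aestronglyMeasurable (by fun_prop)),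
        intervalIntegral.integral_of_le (by linarith [pi_pos])]
      simp only [hdensity, smul_eq_mul]
    _ = ∫ θ in -π - β..-π - β + 2 * π,
          vonMisesPDFReal κ θ * h (cos (θ + β), sin (θ + β)) := by
      rw [show -π - β + 2 * π = π - β by ring, ← intervalIntegral.integral_comp_sub_right]
      simp only [sub_add_cancel]
    _ = ∫ θ in -π..π, vonMisesPDFReal κ θ * h (cos (θ + β), sin (θ + β)) := by
      rw [hperiodic.intervalIntegral_add_eq _ (-π), show -π + 2 * π = π by ring]

lemma integral_fst_vonMises (κ β : ℝ) :
    ∫ s, s.1 ∂vonMises (cos β, sin β) κ = r₁ κ * cos β := by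
  rw [integral_vonMises κ β continuous_fst]
  simp only [cos_add, mul_sub, ← mul_assoc]
  rw [intervalIntegral.integral_sub (by exact Continuous.intervalIntegrable (by fun_prop) _ _)
    (by exact Continuous.intervalIntegrable (by fun_prop) _ _),
    intervalIntegral.integral_mul_const, intervalIntegral.integral_mul_const,
    integral_vonMisesPDFReal_mul_cos, integral_vonMisesPDFReal_mul_sin, zero_mul, sub_zero]

lemma ae_vonMises_sq_add_sq (m : ℝ × ℝ) (κ : ℝ) :
    ∀ᵐ s ∂vonMises m κ, s.1 ^ 2 + s.2 ^ 2 = 1 := by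
  refine (withDensity_absolutelyContinuous _ _).ae_le ?_
  change ∀ᵐ s : ℝ × ℝ ∂_, s.1 ^ 2 + s.2 ^ 2 = 1
  rw [ae_map_iff (by fun_prop) (measurableSet_eq_fun (by fun_prop) (by fun_prop))]
  exact ae_of_all _ fun θ => cos_sq_add_sin_sq θ

lemma memLp_vonMises {m : ℝ × ℝ} {κ : ℝ} [IsFiniteMeasure (vonMises m κ)] {h : ℝ × ℝ → ℝ}
    (hh : Continuous h) (p : ℝ≥0∞) : MemLp h p (vonMises m κ) := by
  obtain ⟨C, hC⟩ := (isCompact_closedBall (0 : ℝ × ℝ) 1).exists_bound_of_continuousOn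
    hh.continuousOn
  refine MemLp.of_bound hh.aestronglyMeasurable C ?_
  filter_upwards [ae_vonMises_sq_add_sq m κ] with s hs
  refine hC s (mem_closedBall_zero_iff.2 (max_le ?_ ?_))
  · exact abs_le_one_iff_mul_self_le_one.2 (by nlinarith [sq_nonneg s.2])
  · exact abs_le_one_iff_mul_self_le_one.2 (by nlinarith [sq_nonneg s.1])

lemma diagDir_eq_cos_sin : diagDir = (cos (π / 4), sin (π / 4)) := by
  rw [cos_pi_div_four, sin_pi_div_four, sqrt_div_self', diagDir]

lemma integral_fst_vonMises_diagDir (κ : ℝ) :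
    ∫ s, s.1 ∂vonMises diagDir κ = r₁ κ / √2 := by
  rw [diagDir_eq_cos_sin, integral_fst_vonMises, cos_pi_div_four, sqrt_div_self', mul_one_div]

lemma integral_comp_swap_vonMises_diagDir (κ : ℝ) {h : ℝ × ℝ → ℝ} (hh : Continuous h) :
    ∫ s, h s.swap ∂vonMises diagDir κ = ∫ s, h s ∂vonMises diagDir κ := by
  have hreflect (θ : ℝ) : (cos (θ + π / 4), sin (θ + π / 4)).swap =
      (cos (-θ + π / 4), sin (-θ + π / 4)) := by
    rw [Prod.swap_prod_mk, show -θ + π / 4 = π / 2 - (θ + π / 4) by ring, cos_pi_div_two_sub,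
      sin_pi_div_two_sub]
  rw [diagDir_eq_cos_sin, integral_vonMises κ _ (h := fun s => h s.swap) (by fun_prop),
    integral_vonMises κ _ hh, ← integral_vonMisesPDFReal_mul_comp_neg]
  simp only [hreflect, neg_neg]

lemma integral_snd_sq_vonMises_diagDir (κ : ℝ) :
    ∫ s, s.2 ^ 2 ∂vonMises diagDir κ = ∫ s, s.1 ^ 2 ∂vonMises diagDir κ :=
  integral_comp_swap_vonMises_diagDir κ (h := fun s => s.1 ^ 2) (by fun_prop)

lemma integral_fst_sq_vonMises_diagDir (κ : ℝ) [IsProbabilityMeasure (vonMises diagDir κ)] :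
    ∫ s, s.1 ^ 2 ∂vonMises diagDir κ = 1 / 2 := by
  have hsum : ∫ s, (s.1 ^ 2 + s.2 ^ 2) ∂vonMises diagDir κ = 1 := by
    rw [integral_congr_ae (ae_vonMises_sq_add_sq _ _), integral_const, probReal_univ, one_smul]
  rw [integral_add (memLp_one_iff_integrable.1 (memLp_vonMises (by fun_prop) 1))
    (memLp_one_iff_integrable.1 (memLp_vonMises (by fun_prop) 1)),
    integral_snd_sq_vonMises_diagDir] at hsum
  linarith

end VonMises

section ParamLaw

variable {φ : ℝ → ℝ → ℝ}

lemma ae_fst_pos_paramLaw (φ : ℝ → ℝ → ℝ) : ∀ᵐ p ∂paramLaw φ, 0 < p.1 := by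
  refine (withDensity_absolutelyContinuous _ _).ae_le ?_
  filter_upwards [ae_restrict_mem (measurableSet_Ioi.prod MeasurableSet.univ)] with p hp
  exact hp.1

/-- The reversal `(α², ω) ↦ (α², -ω)` of the frequency of an oscillator. -/
def freqNeg : ℝ × ℝ ≃ᵐ ℝ × ℝ := (MeasurableEquiv.refl ℝ).prodCongr (MeasurableEquiv.neg ℝ)

lemma measurePreserving_freqNeg_paramLaw (hφm : Measurable (Function.uncurry φ))
    (hφs : ∀ x ω, 0 < x → φ x (-ω) = φ x ω) :
    MeasurePreserving freqNeg (paramLaw φ) (paramLaw φ) := by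
  have hvol : MeasurePreserving freqNeg (volume.restrict (Set.Ioi 0 ×ˢ Set.univ))
      (volume.restrict (Set.Ioi 0 ×ˢ Set.univ)) :=
    ((MeasurePreserving.id volume).prod (Measure.measurePreserving_neg volume)).restrict_preimage
      (measurableSet_Ioi.prod MeasurableSet.univ)
  refine ⟨freqNeg.measurable, Measure.ext fun A hA => ?_⟩
  have hφm' : Measurable fun p : ℝ × ℝ => ENNReal.ofReal (φ p.1 p.2) := hφm.ennreal_ofReal
  rw [freqNeg.map_apply, paramLaw, withDensity_apply _ hA,
    withDensity_apply _ (freqNeg.measurable hA), ← hvol.setLIntegral_comp_preimage hA hφm']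
  refine lintegral_congr_ae (ae_restrict_of_ae ?_)
  filter_upwards [ae_restrict_mem (measurableSet_Ioi.prod MeasurableSet.univ)] with p hp
  exact congrArg ENNReal.ofReal (hφs p.1 p.2 hp.1).symm

variable (hφm : Measurable (Function.uncurry φ)) (hφ : ∀ x ω, 0 < x → 0 ≤ φ x ω)
  {h : ℝ × ℝ → ℝ}

include hφm hφ

lemma integrable_paramLaw_iff :
    Integrable h (paramLaw φ) ↔
      IntegrableOn (fun p => h p * φ p.1 p.2) (Set.Ioi 0 ×ˢ Set.univ) := by
  have hφm' : Measurable fun p : ℝ × ℝ => ENNReal.ofReal (φ p.1 p.2) := hφm.ennreal_ofReal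
  rw [paramLaw, integrable_withDensity_iff_integrable_smul' hφm'
    (ae_of_all _ fun _ => ENNReal.ofReal_lt_top), IntegrableOn]
  refine integrable_congr ?_
  filter_upwards [ae_restrict_mem (measurableSet_Ioi.prod MeasurableSet.univ)] with p hp
  rw [ENNReal.toReal_ofReal (hφ _ _ hp.1), smul_eq_mul, mul_comm]

lemma integral_paramLaw_eq_setIntegral :
    ∫ p, h p ∂paramLaw φ = ∫ p in Set.Ioi 0 ×ˢ Set.univ, h p * φ p.1 p.2 := by
  have hφm' : Measurable fun p : ℝ × ℝ => ENNReal.ofReal (φ p.1 p.2) := hφm.ennreal_ofReal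
  rw [paramLaw, integral_withDensity_eq_integral_toReal_smul hφm'
    (ae_of_all _ fun _ => ENNReal.ofReal_lt_top)]
  refine setIntegral_congr_fun (measurableSet_Ioi.prod MeasurableSet.univ) fun p hp => ?_
  rw [ENNReal.toReal_ofReal (hφ _ _ hp.1), smul_eq_mul, mul_comm]

lemma integral_paramLaw (hh : Integrable h (paramLaw φ)) :
    ∫ p, h p ∂paramLaw φ = ∫ ω, ∫ x in Set.Ioi 0, h (x, ω) * φ x ω := by
  rw [integrable_paramLaw_iff hφm hφ, IntegrableOn, Measure.volume_eq_prod,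
    ← Measure.prod_restrict, Measure.restrict_univ] at hh
  rw [integral_paramLaw_eq_setIntegral hφm hφ, Measure.volume_eq_prod, ← Measure.prod_restrict,
    Measure.restrict_univ, integral_prod_symm _ hh]

end ParamLaw

section Response

/-- The envelope `α² exp (-α² t / 2)` of the impulse response of an oscillator with parameters
`p = (α², ω)`. -/
noncomputable def envelope (t : ℝ) (p : ℝ × ℝ) : ℝ := p.1 * Real.exp (-(p.1 * t / 2))

/-- The component of the impulse response of an oscillator with parameters `p = (α², ω)` that is
in phase with `cos (ω t)`. -/
noncomputable def inPhase (t : ℝ) (p : ℝ × ℝ) : ℝ := envelope t p * Real.cos (p.2 * t)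

/-- The component of the impulse response of an oscillator with parameters `p = (α², ω)` that is
in quadrature to `cos (ω t)`. -/
noncomputable def quadrature (t : ℝ) (p : ℝ × ℝ) : ℝ := envelope t p * Real.sin (p.2 * t)

/-- The impulse response at time `t` of one oscillator with parameters `z = ((α², ω), s)`. -/
noncomputable def response (t : ℝ) (z : (ℝ × ℝ) × (ℝ × ℝ)) : ℝ :=
  quadrature t z.1 * z.2.2 - inPhase t z.1 * z.2.1

@[fun_prop]
lemma continuous_envelope (t : ℝ) : Continuous (envelope t) := by
  unfold envelope
  fun_prop

@[fun_prop]
lemma continuous_inPhase (t : ℝ) : Continuous (inPhase t) := by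
  unfold inPhase
  fun_prop

@[fun_prop]
lemma continuous_quadrature (t : ℝ) : Continuous (quadrature t) := by
  unfold quadrature
  fun_prop

lemma continuous_response (t : ℝ) : Continuous (response t) := by
  unfold response
  fun_prop

lemma inPhase_freqNeg (t : ℝ) (p : ℝ × ℝ) : inPhase t (freqNeg p) = inPhase t p := by
  change envelope t p * Real.cos (-p.2 * t) = _
  rw [neg_mul, Real.cos_neg, inPhase]

lemma quadrature_freqNeg (t : ℝ) (p : ℝ × ℝ) : quadrature t (freqNeg p) = -quadrature t p := by
  change envelope t p * Real.sin (-p.2 * t) = _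
  rw [neg_mul, Real.sin_neg, mul_neg, quadrature]

lemma inPhase_mul_inPhase_add_quadrature_mul_quadrature (t t' : ℝ) (p : ℝ × ℝ) :
    inPhase t p * inPhase t' p + quadrature t p * quadrature t' p =
      p.1 ^ 2 * Real.exp (-(p.1 * (t + t') / 2)) * Real.cos (p.2 * (t - t')) := by
  rw [mul_sub, Real.cos_sub, show -(p.1 * (t + t') / 2) = -(p.1 * t / 2) + -(p.1 * t' / 2) by ring,
    Real.exp_add, inPhase, inPhase, quadrature, quadrature, envelope, envelope]
  ring

lemma impulseResponse_eq_sum_response (n : ℕ) (α ω : ℕ → ℝ) (s : ℕ → ℝ × ℝ) (t : ℝ) :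
    impulseResponse n α ω s t =
      ∑ i ∈ Finset.range n, response t (((α i) ^ 2, ω i), s i) := by
  refine Finset.sum_congr rfl fun i _ => ?_
  rw [response, inPhase, quadrature, envelope]
  ring

end Response

section Integrability

lemma memLp_envelope_of_pos (φ : ℝ → ℝ → ℝ) [IsFiniteMeasure (paramLaw φ)] {t : ℝ} (ht : 0 < t)
    (q : ℝ≥0∞) : MemLp (envelope t) q (paramLaw φ) := by
  refine MemLp.of_bound (continuous_envelope t).aestronglyMeasurable (2 / t) ?_
  filter_upwards [ae_fst_pos_paramLaw φ] with p hp
  rw [envelope, Real.norm_eq_abs, abs_of_nonneg (by positivity), Real.exp_neg,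
    ← div_eq_mul_inv, div_le_div_iff₀ (Real.exp_pos _) ht]
  linarith [Real.add_one_le_exp (p.1 * t / 2)]

lemma memLp_envelope_of_nonneg {φ : ℝ → ℝ → ℝ} {q : ℝ≥0∞}
    (hfst : MemLp Prod.fst q (paramLaw φ)) {t : ℝ} (ht : 0 ≤ t) :
    MemLp (envelope t) q (paramLaw φ) := by
  refine hfst.mono (continuous_envelope t).aestronglyMeasurable ?_
  filter_upwards [ae_fst_pos_paramLaw φ] with p hp
  rw [envelope, norm_mul, Real.norm_eq_abs (Real.exp _), Real.abs_exp]
  exact mul_le_of_le_one_right (norm_nonneg _)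
    (Real.exp_le_one_iff.2 (by have := mul_nonneg hp.le ht; linarith))

lemma memLp_fst_paramLaw {φ : ℝ → ℝ → ℝ} (hφm : Measurable (Function.uncurry φ))
    (hφ : ∀ x ω, 0 < x → 0 ≤ φ x ω)
    (hint : IntegrableOn (fun p : ℝ × ℝ => p.1 ^ 2 * φ p.1 p.2) (Set.Ioi 0 ×ˢ Set.univ)) :
    MemLp Prod.fst 2 (paramLaw φ) :=
  (memLp_two_iff_integrable_sq (by fun_prop)).2 ((integrable_paramLaw_iff hφm hφ).2 hint)

variable {μ : Measure (ℝ × ℝ)} {q : ℝ≥0∞} {t : ℝ} (henv : MemLp (envelope t) q μ)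

include henv

lemma memLp_inPhase : MemLp (inPhase t) q μ :=
  henv.mono (continuous_inPhase t).aestronglyMeasurable <| ae_of_all _ fun p => by
    rw [inPhase, norm_mul]
    exact mul_le_of_le_one_right (norm_nonneg _) (Real.abs_cos_le_one _)

lemma memLp_quadrature : MemLp (quadrature t) q μ :=
  henv.mono (continuous_quadrature t).aestronglyMeasurable <| ae_of_all _ fun p => by
    rw [quadrature, norm_mul]
    exact mul_le_of_le_one_right (norm_nonneg _) (Real.abs_sin_le_one _)

end Integrability

section Moments

lemma memLp_two_mul_prod {X Y : Type*} [MeasurableSpace X] [MeasurableSpace Y] {μ : Measure X}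
    {ν : Measure Y} [SFinite ν] {u : X → ℝ} {v : Y → ℝ} (hu : MemLp u 2 μ) (hv : MemLp v 2 ν) :
    MemLp (fun z : X × Y => u z.1 * v z.2) 2 (μ.prod ν) := by
  refine (memLp_two_iff_integrable_sq (hu.1.comp_fst.mul hv.1.comp_snd)).2 ?_
  simpa only [Pi.mul_apply, mul_pow] using hu.integrable_sq.mul_prod hv.integrable_sq

lemma integral_eq_zero_of_comp_eq_neg {X : Type*} [MeasurableSpace X] {μ : Measure X} {e : X ≃ᵐ X}
    (he : MeasurePreserving e μ μ) {h : X → ℝ} (hodd : ∀ x, h (e x) = -h x) :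
    ∫ x, h x ∂μ = 0 := by
  have hneg := he.integral_comp' h
  simp only [hodd, integral_neg] at hneg
  linarith

variable {μ ν : Measure (ℝ × ℝ)} [SFinite ν] {t t' : ℝ}

lemma memLp_response (henv : MemLp (envelope t) 2 μ) (h₁ : MemLp Prod.fst 2 ν)
    (h₂ : MemLp Prod.snd 2 ν) : MemLp (response t) 2 (μ.prod ν) :=
  (memLp_two_mul_prod (memLp_quadrature henv) h₂).sub (memLp_two_mul_prod (memLp_inPhase henv) h₁)

variable [SFinite μ] (hμ : MeasurePreserving freqNeg μ μ)

include hμ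

lemma integral_response (henv : Integrable (envelope t) μ) (h₁ : Integrable Prod.fst ν)
    (h₂ : Integrable Prod.snd ν) :
    ∫ z, response t z ∂μ.prod ν = -(∫ s, s.1 ∂ν) * ∫ p, inPhase t p ∂μ := by
  rw [← memLp_one_iff_integrable] at henv
  have hinPhase := memLp_one_iff_integrable.1 (memLp_inPhase henv)
  have hquadrature := memLp_one_iff_integrable.1 (memLp_quadrature henv)
  simp only [response]
  rw [integral_sub (hquadrature.mul_prod h₂) (hinPhase.mul_prod h₁),
    integral_prod_mul (quadrature t) Prod.snd, integral_prod_mul (inPhase t) Prod.fst,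
    integral_eq_zero_of_comp_eq_neg hμ (quadrature_freqNeg t)]
  ring

lemma integral_response_mul_response (henv : MemLp (envelope t) 2 μ)
    (henv' : MemLp (envelope t') 2 μ) (h₁ : MemLp Prod.fst 2 ν) (h₂ : MemLp Prod.snd 2 ν)
    (h₁₂ : ∫ s, s.2 ^ 2 ∂ν = ∫ s, s.1 ^ 2 ∂ν) :
    (μ.prod ν)[response t * response t'] =
      (∫ s, s.1 ^ 2 ∂ν) * μ[inPhase t * inPhase t' + quadrature t * quadrature t'] := by
  have hII := (memLp_inPhase henv).integrable_mul (memLp_inPhase henv')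
  have hQQ := (memLp_quadrature henv).integrable_mul (memLp_quadrature henv')
  have hcross := ((memLp_inPhase henv).integrable_mul (memLp_quadrature henv')).add
    ((memLp_quadrature henv).integrable_mul (memLp_inPhase henv'))
  have hodd : μ[inPhase t * quadrature t' + quadrature t * inPhase t'] = 0 :=
    integral_eq_zero_of_comp_eq_neg hμ fun p => by
      simp only [Pi.add_apply, Pi.mul_apply, inPhase_freqNeg, quadrature_freqNeg]
      ring
  have hexpand : response t * response t' =
      (fun z => (inPhase t * inPhase t') z.1 * z.2.1 ^ 2) +
        (fun z => (quadrature t * quadrature t') z.1 * z.2.2 ^ 2) -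
        fun z => (inPhase t * quadrature t' + quadrature t * inPhase t') z.1 *
          (Prod.fst * Prod.snd : ℝ × ℝ → ℝ) z.2 := by
    ext z
    simp only [response, Pi.add_apply, Pi.sub_apply, Pi.mul_apply]
    ring
  rw [hexpand,
    integral_sub' ((hII.mul_prod h₁.integrable_sq).add (hQQ.mul_prod h₂.integrable_sq))
      (hcross.mul_prod (h₁.integrable_mul h₂)),
    integral_add' (hII.mul_prod h₁.integrable_sq) (hQQ.mul_prod h₂.integrable_sq),
    integral_prod_mul _ fun s : ℝ × ℝ => s.1 ^ 2, integral_prod_mul _ fun s : ℝ × ℝ => s.2 ^ 2,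
    integral_prod_mul, hodd, h₁₂, zero_mul, sub_zero, ← add_mul, ← integral_add' hII hQQ, mul_comm]

end Moments

section Convergence

variable {κ : ℝ} {φ : ℝ → ℝ → ℝ} (hφm : Measurable (Function.uncurry φ))
  (hφ : ∀ x ω, 0 < x → 0 ≤ φ x ω) {t t' : ℝ}

include hφm hφ

lemma muH_eq_integral_paramLaw (henv : Integrable (envelope t) (paramLaw φ)) :
    muH κ φ t = -(r₁ κ / √2) * ∫ p, inPhase t p ∂paramLaw φ := by
  rw [integral_paramLaw hφm hφ
    (memLp_one_iff_integrable.1 (memLp_inPhase (memLp_one_iff_integrable.2 henv)))]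
  rfl

lemma limitKernel_eq_integral_paramLaw (henv : MemLp (envelope t) 2 (paramLaw φ))
    (henv' : MemLp (envelope t') 2 (paramLaw φ)) :
    limitKernel κ φ t t' =
      1 / 2 * (paramLaw φ)[inPhase t * inPhase t' + quadrature t * quadrature t'] -
        muH κ φ t * muH κ φ t' := by
  rw [integral_paramLaw hφm hφ (((memLp_inPhase henv).integrable_mul (memLp_inPhase henv')).add
    ((memLp_quadrature henv).integrable_mul (memLp_quadrature henv')))]
  simp only [Pi.add_apply, Pi.mul_apply, inPhase_mul_inPhase_add_quadrature_mul_quadrature]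
  rfl

variable (hφs : ∀ x ω, 0 < x → φ x (-ω) = φ x ω)

include hφs

lemma integral_response_eq_muH [SFinite (paramLaw φ)] [IsProbabilityMeasure (vonMises diagDir κ)]
    (henv : Integrable (envelope t) (paramLaw φ)) :
    ∫ z, response t z ∂(paramLaw φ).prod (vonMises diagDir κ) = muH κ φ t := by
  rw [integral_response (measurePreserving_freqNeg_paramLaw hφm hφs) henv
    (memLp_one_iff_integrable.1 (memLp_vonMises continuous_fst 1))
    (memLp_one_iff_integrable.1 (memLp_vonMises continuous_snd 1)),
    integral_fst_vonMises_diagDir, muH_eq_integral_paramLaw hφm hφ henv]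

lemma covariance_response_eq_limitKernel [IsProbabilityMeasure (paramLaw φ)]
    [IsProbabilityMeasure (vonMises diagDir κ)]
    (henv : MemLp (envelope t) 2 (paramLaw φ))
    (henv' : MemLp (envelope t') 2 (paramLaw φ)) :
    cov[response t, response t'; (paramLaw φ).prod (vonMises diagDir κ)] =
      limitKernel κ φ t t' := by
  have h₁ : MemLp Prod.fst 2 (vonMises diagDir κ) := memLp_vonMises continuous_fst 2
  have h₂ : MemLp Prod.snd 2 (vonMises diagDir κ) := memLp_vonMises continuous_snd 2
  rw [covariance_eq_sub (memLp_response henv h₁ h₂) (memLp_response henv' h₁ h₂),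
    integral_response_eq_muH hφm hφ hφs (henv.integrable one_le_two),
    integral_response_eq_muH hφm hφ hφs (henv'.integrable one_le_two),
    limitKernel_eq_integral_paramLaw hφm hφ henv henv',
    integral_response_mul_response (measurePreserving_freqNeg_paramLaw hφm hφs) henv henv' h₁ h₂
      (integral_snd_sq_vonMises_diagDir κ), integral_fst_sq_vonMises_diagDir]

theorem convergesToGP_impulseResponse {Ω : Type*} [MeasurableSpace Ω] {P : Measure Ω}
    [IsProbabilityMeasure P] {α w : ℕ → Ω → ℝ} {s : ℕ → Ω → ℝ × ℝ}
    (h_param : ∀ i, HasLaw (fun o => ((α i o) ^ 2, w i o)) (paramLaw φ) P)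
    (h_vm : ∀ i, HasLaw (s i) (vonMises diagDir κ) P)
    (h_indep : ∀ i, IndepFun (fun o => ((α i o) ^ 2, w i o)) (s i) P)
    (h_iIndep : iIndepFun (fun i o => (((α i o) ^ 2, w i o), s i o)) P)
    {T : Set ℝ} (hT : ∀ t ∈ T, MemLp (envelope t) 2 (paramLaw φ)) :
    ConvergesToGP P T
      (fun n t o => √(n : ℝ) *
        (impulseResponse n (fun i => α i o) (fun i => w i o) (fun i => s i o) t / n - muH κ φ t))
      (limitKernel κ φ) := by
  have : IsProbabilityMeasure (paramLaw φ) := (h_param 0).isProbabilityMeasure_iff.1 inferInstance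
  have : IsProbabilityMeasure (vonMises diagDir κ) :=
    (h_vm 0).isProbabilityMeasure_iff.1 inferInstance
  have hlaw (i : ℕ) : HasLaw (fun o => (((α i o) ^ 2, w i o), s i o))
      ((paramLaw φ).prod (vonMises diagDir κ)) P := (h_indep i).hasLaw_prod (h_param i) (h_vm i)
  simp only [impulseResponse_eq_sum_response]
  exact convergesToGP_of_iid hlaw h_iIndep (fun t => (continuous_response t).measurable)
    (fun t ht => memLp_response (hT t ht) (memLp_vonMises continuous_fst 2)
      (memLp_vonMises continuous_snd 2))
    (fun t ht => integral_response_eq_muH hφm hφ hφs ((hT t ht).integrable one_le_two))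
    (fun t ht t' ht' => covariance_response_eq_limitKernel hφm hφ hφs (hT t ht) (hT t' ht'))

end Convergence

end QWiener

theorem mainTheorem3 {Ω : Type*} [MeasurableSpace Ω] (P : Measure Ω) [IsProbabilityMeasure P]
    (κ : ℝ) (hκ : 0 < κ)
    (φ : ℝ → ℝ → ℝ) (hφ_meas : Measurable (Function.uncurry φ))
    (hφ_nonneg : ∀ x ω, 0 < x → 0 ≤ φ x ω)
    (hφ_symm : ∀ x ω, 0 < x → φ x (-ω) = φ x ω)
    (α w : ℕ → Ω → ℝ) (s : ℕ → Ω → ℝ × ℝ)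
    (h_param : ∀ i, HasLaw (fun o => ((α i o) ^ 2, w i o)) (QWiener.paramLaw φ) P)
    (h_vm : ∀ i, HasLaw (s i) (QWiener.vonMises QWiener.diagDir κ) P)
    (h_indep : ∀ i, IndepFun (fun o => ((α i o) ^ 2, w i o)) (s i) P)
    (h_iIndep : iIndepFun (fun i o => (((α i o) ^ 2, w i o), s i o)) P) :
    QWiener.ConvergesToGP P (Set.Ioi 0)
      (fun n t o => √(n : ℝ) *
        (QWiener.impulseResponse n (fun i => α i o) (fun i => w i o) (fun i => s i o) t / n
          - QWiener.muH κ φ t))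
      (QWiener.limitKernel κ φ) ∧
    (IntegrableOn (fun p : ℝ × ℝ => p.1 ^ 2 * φ p.1 p.2) (Set.Ioi 0 ×ˢ Set.univ) →
      QWiener.ConvergesToGP P (Set.Ici 0)
        (fun n t o => √(n : ℝ) *
          (QWiener.impulseResponse n (fun i => α i o) (fun i => w i o) (fun i => s i o) t / n
            - QWiener.muH κ φ t))
        (QWiener.limitKernel κ φ)) ∧
    ∀ a_m a_M : ℝ, 0 < a_m → a_m < a_M →
      (∀ t : ℝ, 0 < t →
        QWiener.muH κ (QWiener.cauchyUniform a_m a_M) t =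
          -(QWiener.r₁ κ / √2) *
            (((1 + a_m * t) * Real.exp (-(a_m * t)) - Real.exp (-(a_M * t)) * (1 + a_M * t)) /
              (t ^ 2 * (a_M - a_m)))) ∧
      (∀ t t' τ : ℝ, 0 ≤ t → 0 ≤ t' → τ = max t t' → 0 < τ →
        QWiener.limitKernel κ (QWiener.cauchyUniform a_m a_M) t t' =
          1 / 2 * (2 * ((1 + a_m * τ + a_m ^ 2 * τ ^ 2 / 2) * Real.exp (-(a_m * τ)) -
              Real.exp (-(a_M * τ)) * (1 + a_M * τ + a_M ^ 2 * τ ^ 2 / 2)) /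
              (τ ^ 3 * (a_M - a_m)))
            - QWiener.muH κ (QWiener.cauchyUniform a_m a_M) t *
              QWiener.muH κ (QWiener.cauchyUniform a_m a_M) t') := by
  have hconv {T : Set ℝ} :=
    QWiener.convergesToGP_impulseResponse hφ_meas hφ_nonneg hφ_symm h_param h_vm h_indep h_iIndep
      (T := T)
  have : IsProbabilityMeasure (QWiener.paramLaw φ) :=
    (h_param 0).isProbabilityMeasure_iff.1 inferInstance
  refine ⟨hconv fun t ht => QWiener.memLp_envelope_of_pos φ ht 2, fun hint => ?_,
    fun a_m a_M ha haM => ⟨fun t ht => QWiener.muH_cauchyUniform κ ha haM.le ht, ?_⟩⟩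
  · have hfst := QWiener.memLp_fst_paramLaw hφ_meas hφ_nonneg hint
    exact hconv fun t ht => QWiener.memLp_envelope_of_nonneg hfst ht
  · rintro t t' τ - - rfl hτ
    exact QWiener.limitKernel_cauchyUniform κ ha haM.le hτ.ne'
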